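/- Let $(p_N)_{N\ge 1}$ be a sequence in $[0,1]$ with $\frac{\log N}{N p_N}\to 0$ as $N\to\infty$ (in particular $p_N>0$ for all large $N$), and let $G_{N,p_N}$ be the Erd\H{o}s--R\'enyi random graph on $N$ nodes, in which each pair of distinct nodes is joined independently with probability $p_N$. For a graph $G$ on $N$ nodes with adjacency matrix $A$ and degree matrix $D$, put $\tilde A=A+I_N$, $\tilde D=D+I_N$, let $\tilde\Delta=I_N-\tilde D^{-1/2}\tilde A\tilde D^{-1/2}$ be the augmented normalized Laplacian, and let $P=I_N-\tilde\Delta$. Let $\lambda_1\le\dots\le\lambda_N$ be the eigenvalues of $P$ with multiplicity, let $M$ be the number of connected components of $G$, and let $\lambda=\lambda(G)=\max_{1\le n\le N-M}|\lambda_n|$ ($\lambda=0$ if $M=N$). A GCN on $G$ with $C\ge 1$ channels and weights $W_l\in\mathbb R^{C\times C}$ ($l=1,2,\dots$) consists of the layers $X\mapsto\sigma(PXW_l)$ on $\mathbb R^{N\times C}$, where $\sigma$ is the entrywise ReLU; let $s=\sup_l s_l$, where $s_l$ is the maximum singular value of $W_l$. Then for every $\varepsilon>0$ there is an $N_0$,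 depending only on $\varepsilon$ and the sequence $(p_N)$, such that for all $N\ge N_0$, all $C\ge1$ and all weights $(W_l)$ with $$s<\frac17\sqrt{\frac{Np_N-p_N+1}{\log(4N/\varepsilon)}},$$ the GCN on $G_{N,p_N}$ with weights $(W_l)$ satisfies $s\,\lambda(G_{N,p_N})<1$ with probability at least $1-\varepsilon$. -/

import Mathlib

open Filter Asymptotics Matrix

noncomputable section

namespace GraphConv

section Graph

variable {N : ℕ} (G : SimpleGraph (Fin N))

open Classical in
/-- The adjacency matrix augmented with self-loops, `A + I`. -/
def augAdj : Matrix (Fin N) (Fin N) ℝ := G.adjMatrix ℝ + 1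

open Classical in
/-- The degrees augmented with self-loops, `deg i + 1`: the diagonal of `D + I`. -/
def augDeg (i : Fin N) : ℝ := (G.degree i : ℝ) + 1

/-- The diagonal matrix `(D + I)^(-1/2)`; all entries `deg i + 1` are positive. -/
def augDegInvSqrt : Matrix (Fin N) (Fin N) ℝ :=
  Matrix.diagonal fun i => (Real.sqrt (augDeg G i))⁻¹

/-- The augmented normalized Laplacian `I - (D + I)^(-1/2) (A + I) (D + I)^(-1/2)`. -/
def augNormLaplacian : Matrix (Fin N) (Fin N) ℝ :=
  1 - augDegInvSqrt G * augAdj G * augDegInvSqrt G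

/-- The propagation matrix `P`: the identity minus the augmented normalized Laplacian. -/
def propagation : Matrix (Fin N) (Fin N) ℝ := 1 - augNormLaplacian G

theorem propagation_isHermitian : (propagation G).IsHermitian := by
  classical
  have h : propagation G = augDegInvSqrt G * augAdj G * augDegInvSqrt G := by
    simp [propagation, augNormLaplacian]
  have hD : (augDegInvSqrt G)ᴴ = augDegInvSqrt G := by
    simp [augDegInvSqrt]
  have hA : (augAdj G)ᴴ = augAdj G := by
    ext i j
    simp [augAdj, SimpleGraph.adjMatrix_apply, Matrix.one_apply, G.adj_comm, eq_comm]
  rw [h, Matrix.IsHermitian, Matrix.conjTranspose_mul, Matrix.conjTranspose_mul, hD, hA,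
    Matrix.mul_assoc]

/-- The number `M` of connected components of the graph. -/
def numComponents : ℕ := Nat.card G.ConnectedComponent

/-- The rate `λ`: the largest absolute value among the eigenvalues of `P` that remain when the
eigenvalues are listed with multiplicity in decreasing order and the first `M` of them are
removed, where `M` is the number of connected components. The maximum over the empty list
(the case `M = N`) is `0`. -/
def spectralRate : ℝ :=
  ⨆ i : {i : Fin (Fintype.card (Fin N)) // numComponents G ≤ (i : ℕ)},
    |(propagation_isHermitian G).eigenvalues₀ i.1|

end Graph

/-- The maximum singular value of a square real matrix (singular values are listed in decreasing
order, starting at index `0`). -/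
def maxSingularValue {C : ℕ} (W : Matrix (Fin C) (Fin C) ℝ) : ℝ :=
  (Matrix.toEuclideanLin W).singularValues 0

/-- A graph convolutional network on `N` nodes with `C` channels: a graph and one weight matrix
for each layer. -/
structure GCN (N C : ℕ) where
  /-- the underlying graph -/
  graph : SimpleGraph (Fin N)
  /-- the weights of the layers -/
  weight : ℕ → Matrix (Fin C) (Fin C) ℝ

namespace GCN

variable {N C : ℕ} (g : GCN N C)

/-- The `l`-th layer, `X ↦ σ (P X W_l)` with the entrywise ReLU function `σ`. -/
def layer (l : ℕ) (X : Matrix (Fin N) (Fin C) ℝ) : Matrix (Fin N) (Fin C) ℝ :=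
  (propagation g.graph * X * g.weight l).map fun t => max t 0

/-- The signal after the first `l` layers. -/
def output (X : Matrix (Fin N) (Fin C) ℝ) : ℕ → Matrix (Fin N) (Fin C) ℝ
  | 0 => X
  | l + 1 => g.layer l (output X l)

/-- The supremum `s` of the maximum singular values of the weights (meaningful when these are
bounded above). -/
def weightSup : ℝ := ⨆ l, maxSingularValue (g.weight l)

/-- The condition `s λ < 1` for exponential information loss. -/
def InfoLossCondition : Prop :=
  BddAbove (Set.range fun l => maxSingularValue (g.weight l)) ∧
    g.weightSup * spectralRate g.graph < 1

end GCN

end GraphConv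

end

/-! Write `A + I = p J + (1 - p) I + X` with `J` the all-ones matrix and `X` the centered adjacency
matrix. After conjugation by `(D + I)^(-1/2)` the term `p J` is positive semidefinite of rank one,
so by Courant-Fischer it can only affect the top eigenvalue. Since `M ≥ 1`, that eigenvalue is
always discarded, and connectivity of the graph is never needed. All others are at most `(1 + ‖X‖) /
δ` in absolute value, where `δ` bounds the augmented degrees from below (`spectralRate_le`).

The norm of `X` is controlled by `E tr X^(2k)`. Discrete integration by parts in each edge variable
turns this trace into differences of `X^(2k-1)` under an edge flip. A mean value inequality for
traces bounds these differences by diagonal entries of `X^(2k-2)` weighted by `rowWeight`. Young's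
inequality then lets `E tr X^(2k)` be absorbed on the left, leaving only moments of sums of
independent variables (`bernSum_trace_pow_le_rowWeight`).

With `d = N p - p + 1`, `L = log (4 N / ε)` and `k = ⌈L⌉`, Markov gives `‖X‖ ≤ 6 √(d L)`, and a
Chernoff bound gives augmented degrees at least `9 d / 10`; each can fail with probability at most
`ε / 4`. Hence `λ ≤ 7 √(L / d)`, the reciprocal of the threshold for `s`. -/

namespace GraphConv

/-! ### Trace inequalities for symmetric matrices. -/

section Spectral

variable {V : Type*} [Fintype V] [DecidableEq V]

/-- Simultaneous diagonalization of all powers of a symmetric real matrix. -/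
theorem exists_diagonalization {X : Matrix V V ℝ} (hX : X.IsSymm) :
    ∃ (U : Matrix V V ℝ) (l : V → ℝ), U * Uᵀ = 1 ∧ Uᵀ * U = 1 ∧
      ∀ n : ℕ, X ^ n = U * diagonal (fun a => l a ^ n) * Uᵀ := by
  have hH : X.IsHermitian := by
    rw [Matrix.IsHermitian, conjTranspose_eq_transpose_of_trivial]; exact hX
  set U : Matrix V V ℝ := (hH.eigenvectorUnitary : Matrix V V ℝ) with hU
  have h1 : U * Uᵀ = 1 := by
    have := Unitary.mul_star_self_of_mem hH.eigenvectorUnitary.2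
    rwa [star_eq_conjTranspose, conjTranspose_eq_transpose_of_trivial] at this
  have h2 : Uᵀ * U = 1 := by
    have := Unitary.star_mul_self_of_mem hH.eigenvectorUnitary.2
    rwa [star_eq_conjTranspose, conjTranspose_eq_transpose_of_trivial] at this
  have h3 : X = U * diagonal hH.eigenvalues * Uᵀ := by
    have := hH.spectral_theorem
    rw [Unitary.conjStarAlgAut_apply] at this
    simpa [star_eq_conjTranspose, conjTranspose_eq_transpose_of_trivial, Function.comp_def]
      using this
  refine ⟨U, hH.eigenvalues, h1, h2, fun n => ?_⟩
  induction n with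
  | zero => simp [h1]
  | succ n ih =>
    rw [pow_succ, ih]
    nth_rewrite 2 [h3]
    calc U * diagonal (fun a => hH.eigenvalues a ^ n) * Uᵀ * (U * diagonal hH.eigenvalues * Uᵀ)
        = U * diagonal (fun a => hH.eigenvalues a ^ n) * (Uᵀ * U) * diagonal hH.eigenvalues * Uᵀ := by
          simp only [Matrix.mul_assoc]
      _ = _ := by
          rw [h2, Matrix.mul_one, Matrix.mul_assoc U, diagonal_mul_diagonal]
          simp only [pow_succ]

/-- The diagonal entries of a matrix given in diagonalized form. -/
theorem diag_entry_eq (U : Matrix V V ℝ) (f : V → ℝ) (i : V) :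
    (U * diagonal f * Uᵀ) i i = ∑ a, U i a ^ 2 * f a := by
  rw [mul_apply]
  exact Finset.sum_congr rfl fun a _ => by rw [mul_diagonal, transpose_apply]; ring

theorem sum_sq_row_eq_one {U : Matrix V V ℝ} (h : U * Uᵀ = 1) (i : V) : ∑ a, U i a ^ 2 = 1 := by
  have := congrFun (congrFun h i) i
  simpa [mul_apply, sq] using this

theorem trace_diagonalized {U : Matrix V V ℝ} (h : Uᵀ * U = 1) (f : V → ℝ) :
    trace (U * diagonal f * Uᵀ) = ∑ a, f a := by
  rw [trace_mul_comm, ← Matrix.mul_assoc, h, Matrix.one_mul, trace_diagonal]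

/-- The trace of a product of two diagonalized matrices. -/
theorem trace_mul_diagonalized (U W : Matrix V V ℝ) (f g : V → ℝ) :
    trace (U * diagonal f * Uᵀ * (W * diagonal g * Wᵀ)) =
      ∑ a, ∑ b, f a * g b * (Uᵀ * W) a b ^ 2 := by
  have h : trace (U * diagonal f * Uᵀ * (W * diagonal g * Wᵀ)) =
      trace (diagonal f * (Uᵀ * W) * (diagonal g * (Uᵀ * W)ᵀ)) := by
    rw [Matrix.mul_assoc U, Matrix.mul_assoc U, trace_mul_comm, transpose_mul, transpose_transpose]
    simp only [Matrix.mul_assoc]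
  rw [h, trace]
  simp only [diag_apply, mul_apply (M := diagonal f * (Uᵀ * W)), diagonal_mul, transpose_apply]
  exact Finset.sum_congr rfl fun a _ => Finset.sum_congr rfl fun b _ => by ring

/-- For nonnegative `a`, `b` this is `(a^q - b^q) (a^r - b^r) ≥ 0` with `q + r = 2 m`. Evenness of
the total exponent reduces the general case to absolute values. -/
theorem pow_mul_pow_add_le (x y : ℝ) {m q : ℕ} (hq : q ≤ 2 * m) :
    x ^ q * y ^ (2 * m - q) + x ^ (2 * m - q) * y ^ q ≤ x ^ (2 * m) + y ^ (2 * m) := by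
  obtain ⟨r, hr⟩ := Nat.exists_eq_add_of_le hq
  have hr' : 2 * m - q = r := by omega
  rw [hr']
  have key : ∀ a b : ℝ, 0 ≤ a → 0 ≤ b → a ^ q * b ^ r + a ^ r * b ^ q ≤ a ^ (q + r) + b ^ (q + r) := by
    intro a b ha hb
    have : 0 ≤ (a ^ q - b ^ q) * (a ^ r - b ^ r) := by
      rcases le_total a b with h | h
      · exact mul_nonneg_of_nonpos_of_nonpos
          (sub_nonpos.2 (pow_le_pow_left₀ ha h q)) (sub_nonpos.2 (pow_le_pow_left₀ ha h r))
      · exact mul_nonneg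
          (sub_nonneg.2 (pow_le_pow_left₀ hb h q)) (sub_nonneg.2 (pow_le_pow_left₀ hb h r))
    rw [pow_add, pow_add]; nlinarith
  have h2 := key |x| |y| (abs_nonneg x) (abs_nonneg y)
  have ev : Even (q + r) := ⟨m, by omega⟩
  rw [← hr] at ev
  rw [← hr, ev.pow_abs, ev.pow_abs] at h2
  refine le_trans (add_le_add ?_ ?_) h2
  · rw [← abs_pow, ← abs_pow, ← abs_mul]; exact le_abs_self _
  · rw [← abs_pow, ← abs_pow, ← abs_mul]; exact le_abs_self _

/-- Factor the difference of powers as a geometric sum times `x - y`, then pair each term of the sum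
with its reflection; every pair is at most `x^(2m) + y^(2m)`. -/
theorem sub_mul_pow_sub_pow_le (x y : ℝ) (m : ℕ) :
    (x - y) * (x ^ (2 * m + 1) - y ^ (2 * m + 1)) ≤
      (2 * m + 1) / 2 * ((x - y) ^ 2 * (x ^ (2 * m) + y ^ (2 * m))) := by
  set S := ∑ q ∈ Finset.range (2 * m + 1), x ^ q * y ^ (2 * m - q) with hS
  have hg : S * (x - y) = x ^ (2 * m + 1) - y ^ (2 * m + 1) := by
    have := (Commute.all x y).geom_sum₂_mul (2 * m + 1)
    simpa [hS] using this
  have hrefl : S = ∑ q ∈ Finset.range (2 * m + 1), x ^ (2 * m - q) * y ^ q := by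
    rw [hS, ← Finset.sum_range_reflect]
    refine Finset.sum_congr rfl fun q hq => ?_
    have hq' := Finset.mem_range.1 hq
    have e1 : 2 * m + 1 - 1 - q = 2 * m - q := by omega
    have e2 : 2 * m - (2 * m - q) = q := by omega
    rw [e1, e2]
  have h2 : 2 * S ≤ (2 * m + 1) * (x ^ (2 * m) + y ^ (2 * m)) := by
    calc 2 * S = ∑ q ∈ Finset.range (2 * m + 1),
          (x ^ q * y ^ (2 * m - q) + x ^ (2 * m - q) * y ^ q) := by
            rw [Finset.sum_add_distrib, ← hS, ← hrefl]; ring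
      _ ≤ ∑ q ∈ Finset.range (2 * m + 1), (x ^ (2 * m) + y ^ (2 * m)) :=
          Finset.sum_le_sum fun q hq =>
            pow_mul_pow_add_le x y (Nat.lt_succ_iff.1 (Finset.mem_range.1 hq))
      _ = _ := by simp; ring
  rw [← hg]
  nlinarith [mul_le_mul_of_nonneg_left h2 (sq_nonneg (x - y))]

/-- A mean value inequality for the trace of odd powers. -/
theorem trace_sub_mul_pow_sub_pow_le {X Y : Matrix V V ℝ} (hX : X.IsSymm) (hY : Y.IsSymm) (m : ℕ) :
    trace ((X - Y) * (X ^ (2 * m + 1) - Y ^ (2 * m + 1))) ≤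
      (2 * m + 1) / 2 * trace ((X - Y) ^ 2 * (X ^ (2 * m) + Y ^ (2 * m))) := by
  obtain ⟨U, l, hU1, hU2, hUX⟩ := exists_diagonalization hX
  obtain ⟨W, r, hW1, hW2, hWY⟩ := exists_diagonalization hY
  -- The mixed traces are sums over pairs of eigenvalues with the nonnegative weights `(Uᵀ W)_ij ^
  -- 2`. Once both sides are written in mixed traces, the scalar inequality can be summed against
  -- these weights, although `X` and `Y` need not commute.
  have hXY : ∀ a b : ℕ, trace (X ^ a * Y ^ b) = ∑ i, ∑ j, l i ^ a * r j ^ b * (Uᵀ * W) i j ^ 2 :=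
    fun a b => by rw [hUX, hWY, trace_mul_diagonalized]
  have hXX : ∀ a : ℕ, trace (X ^ a) = trace (X ^ a * Y ^ 0) := fun a => by simp
  have hYY : ∀ a : ℕ, trace (Y ^ a) = trace (X ^ 0 * Y ^ a) := fun a => by simp
  have e1 : trace ((X - Y) * (X ^ (2 * m + 1) - Y ^ (2 * m + 1))) =
      trace (X ^ (2 * m + 2) * Y ^ 0) - trace (X ^ 1 * Y ^ (2 * m + 1)) -
        trace (X ^ (2 * m + 1) * Y ^ 1) + trace (X ^ 0 * Y ^ (2 * m + 2)) := by
    rw [← hXX, ← hYY, sub_mul, mul_sub, mul_sub, trace_sub, trace_sub, trace_sub,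
      trace_mul_comm Y (X ^ _), ← pow_succ', ← pow_succ']
    simp only [pow_one]
    ring
  have e2 : trace ((X - Y) ^ 2 * (X ^ (2 * m) + Y ^ (2 * m))) =
      trace (X ^ (2 * m + 2) * Y ^ 0) + trace (X ^ 2 * Y ^ (2 * m))
        - 2 * trace (X ^ (2 * m + 1) * Y ^ 1) - 2 * trace (X ^ 1 * Y ^ (2 * m + 1))
        + trace (X ^ (2 * m) * Y ^ 2) + trace (X ^ 0 * Y ^ (2 * m + 2)) := by
    rw [← hXX, ← hYY]
    have x1 : trace (X * Y * X ^ (2 * m)) = trace (X ^ (2 * m + 1) * Y ^ 1) := by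
      rw [trace_mul_comm, ← Matrix.mul_assoc, ← pow_succ, pow_one]
    have x2 : trace (Y * X * X ^ (2 * m)) = trace (X ^ (2 * m + 1) * Y ^ 1) := by
      rw [Matrix.mul_assoc, ← pow_succ', trace_mul_comm, pow_one]
    have x3 : trace (X * Y * Y ^ (2 * m)) = trace (X ^ 1 * Y ^ (2 * m + 1)) := by
      rw [Matrix.mul_assoc, ← pow_succ', pow_one]
    have x4 : trace (Y * X * Y ^ (2 * m)) = trace (X ^ 1 * Y ^ (2 * m + 1)) := by
      rw [Matrix.mul_assoc, trace_mul_comm, Matrix.mul_assoc, ← pow_succ, pow_one]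
    have x5 : trace (Y * Y * X ^ (2 * m)) = trace (X ^ (2 * m) * Y ^ 2) := by
      rw [trace_mul_comm, sq]
    have x6 : X * X * X ^ (2 * m) = X ^ (2 * m + 2) := by rw [← sq, ← pow_add, add_comm]
    have x7 : Y * Y * Y ^ (2 * m) = Y ^ (2 * m + 2) := by rw [← sq, ← pow_add, add_comm]
    have x8 : X * X * Y ^ (2 * m) = X ^ 2 * Y ^ (2 * m) := by rw [← sq]
    have : (X - Y) ^ 2 * (X ^ (2 * m) + Y ^ (2 * m)) =
        X * X * X ^ (2 * m) + X * X * Y ^ (2 * m) - X * Y * X ^ (2 * m) - X * Y * Y ^ (2 * m)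
        - Y * X * X ^ (2 * m) - Y * X * Y ^ (2 * m) + Y * Y * X ^ (2 * m)
        + Y * Y * Y ^ (2 * m) := by
      rw [sq]; noncomm_ring
    rw [this]
    simp only [trace_add, trace_sub]
    rw [x1, x2, x3, x4, x5, x6, x7, x8]
    ring
  rw [e1, e2]
  simp only [hXY, ← Finset.sum_sub_distrib, ← Finset.sum_add_distrib, Finset.mul_sum]
  refine Finset.sum_le_sum fun i _ => Finset.sum_le_sum fun j _ => ?_
  have h := mul_le_mul_of_nonneg_right (sub_mul_pow_sub_pow_le (l i) (r j) m)
    (sq_nonneg ((Uᵀ * W) i j))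
  simp only [pow_zero, mul_one, one_mul, pow_succ] at h ⊢
  linarith

theorem succ_mul_mul_pow_le {v z : ℝ} (hv : 0 ≤ v) (hz : 0 ≤ z) (m : ℕ) :
    (m + 1) * (v * z ^ m) ≤ v ^ (m + 1) + m * z ^ (m + 1) := by
  induction m with
  | zero => simp
  | succ m ih =>
    have h1 : 0 ≤ (v - z) * (v ^ (m + 1) - z ^ (m + 1)) := by
      rcases le_total v z with h | h
      · exact mul_nonneg_of_nonpos_of_nonpos
          (sub_nonpos.2 h) (sub_nonpos.2 (pow_le_pow_left₀ hv h _))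
      · exact mul_nonneg (sub_nonneg.2 h) (sub_nonneg.2 (pow_le_pow_left₀ hz h _))
    have h2 := mul_le_mul_of_nonneg_right ih hz
    push_cast
    rw [pow_succ v (m + 1), pow_succ z (m + 1)]
    rw [pow_succ z m] at h1 h2 ⊢
    linarith

/-- Young's inequality with exponents `m + 1` and `(m + 1) / m`, applied to `v` and `c y`; the free
`c` tunes the coefficient of `y^(m+1)` for the later absorption. -/
theorem mul_pow_le_young {v y c : ℝ} (hv : 0 ≤ v) (hy : 0 ≤ y) (hc : 0 < c) (m : ℕ) :
    v * y ^ m ≤ (c⁻¹ ^ m * v ^ (m + 1)) / (m + 1) + c * m / (m + 1) * y ^ (m + 1) := by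
  have key : v * (c * y) ^ m ≤ v ^ (m + 1) / (m + 1) + m / (m + 1) * (c * y) ^ (m + 1) := by
    have hz : 0 ≤ c * y := by positivity
    have h := succ_mul_mul_pow_le hv hz m
    have hm : (0 : ℝ) < m + 1 := by positivity
    rw [div_mul_eq_mul_div, ← add_div, le_div_iff₀ hm]
    linarith
  have hcm : 0 < c⁻¹ ^ m := by positivity
  have h := mul_le_mul_of_nonneg_left key hcm.le
  have e : c⁻¹ ^ m * c ^ m = 1 := by rw [← mul_pow, inv_mul_cancel₀ hc.ne', one_pow]
  calc v * y ^ m = c⁻¹ ^ m * (v * (c * y) ^ m) := by rw [mul_pow]; linear_combination (-(v * y ^ m)) * e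
    _ ≤ _ := h
    _ = _ := by
      rw [mul_pow, pow_succ c m]
      linear_combination (m / (m + 1) * c * y ^ (m + 1)) * e

/-- A diagonal entry of `X^(2m)` is an average of `(λ_a^2)^m` over the probability weights `U_ia^2`,
so the scalar Young inequality can be averaged. -/
theorem mul_diag_pow_le {X : Matrix V V ℝ} (hX : X.IsSymm) (i : V) {v c : ℝ} (hv : 0 ≤ v)
    (hc : 0 < c) (m : ℕ) :
    v * (X ^ (2 * m)) i i ≤
      (c⁻¹ ^ m * v ^ (m + 1)) / (m + 1) + c * m / (m + 1) * (X ^ (2 * (m + 1))) i i := by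
  obtain ⟨U, l, hU1, hU2, hUX⟩ := exists_diagonalization hX
  rw [hUX, hUX, diag_entry_eq, diag_entry_eq]
  calc v * ∑ a, U i a ^ 2 * l a ^ (2 * m) = ∑ a, U i a ^ 2 * (v * (l a ^ 2) ^ m) := by
        rw [Finset.mul_sum]
        exact Finset.sum_congr rfl fun a _ => by rw [pow_mul]; ring
    _ ≤ ∑ a, U i a ^ 2 * ((c⁻¹ ^ m * v ^ (m + 1)) / (m + 1)
          + c * m / (m + 1) * (l a ^ 2) ^ (m + 1)) :=
        Finset.sum_le_sum fun a _ => mul_le_mul_of_nonneg_left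
          (mul_pow_le_young hv (sq_nonneg _) hc m) (sq_nonneg _)
    _ = _ := by
        simp only [mul_add, Finset.sum_add_distrib, ← Finset.sum_mul, sum_sq_row_eq_one hU1,
          one_mul]
        rw [Finset.mul_sum]
        congr 1
        refine Finset.sum_congr rfl fun a _ => ?_
        rw [← pow_mul]
        ring

/-- The trace of an even power controls the quadratic form. -/
theorem abs_dotProduct_mulVec_le {X : Matrix V V ℝ} (hX : X.IsSymm) {t : ℝ} (ht : 0 ≤ t) {k : ℕ}
    (hk : k ≠ 0) (h : trace (X ^ (2 * k)) ≤ t ^ (2 * k)) (z : V → ℝ) :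
    |z ⬝ᵥ X *ᵥ z| ≤ t * (z ⬝ᵥ z) := by
  obtain ⟨U, l, hU1, hU2, hUX⟩ := exists_diagonalization hX
  have hl : ∀ a, |l a| ≤ t := by
    intro a
    rw [hUX, trace_diagonalized hU2] at h
    have h1 : l a ^ (2 * k) ≤ t ^ (2 * k) := le_trans
      (Finset.single_le_sum (f := fun a => l a ^ (2 * k))
        (fun b _ => (even_two_mul k).pow_nonneg _) (Finset.mem_univ a)) h
    rw [← (even_two_mul k).pow_abs (l a)] at h1
    exact le_of_pow_le_pow_left₀ (by omega) ht h1
  have h0 : z ⬝ᵥ z = ∑ a, (Uᵀ *ᵥ z) a ^ 2 := by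
    have : z ⬝ᵥ z = (Uᵀ *ᵥ z) ⬝ᵥ (Uᵀ *ᵥ z) := by
      rw [dotProduct_mulVec, vecMul_transpose, mulVec_mulVec, hU1, one_mulVec]
    rw [this]; simp [dotProduct, sq]
  have h1 : z ⬝ᵥ X *ᵥ z = ∑ a, l a * (Uᵀ *ᵥ z) a ^ 2 := by
    have e : X = U * diagonal l * Uᵀ := by simpa using hUX 1
    have : z ⬝ᵥ X *ᵥ z = (Uᵀ *ᵥ z) ⬝ᵥ (diagonal l *ᵥ (Uᵀ *ᵥ z)) := by
      rw [e, ← mulVec_mulVec, ← mulVec_mulVec, dotProduct_mulVec, mulVec_transpose]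
    rw [this]
    simp only [dotProduct, mulVec_diagonal]
    exact Finset.sum_congr rfl fun a _ => by ring
  rw [h0, h1, Finset.mul_sum]
  refine (Finset.abs_sum_le_sum_abs _ _).trans (Finset.sum_le_sum fun a _ => ?_)
  rw [abs_mul, abs_of_nonneg (sq_nonneg ((Uᵀ *ᵥ z) a))]
  exact mul_le_mul_of_nonneg_right (hl a) (sq_nonneg _)

end Spectral

/-! ### Expectations over random subsets as finite sums. -/

section Bernoulli

variable {ι : Type*} [DecidableEq ι]

/-- The expectation of `F` at the random subset of `U` that contains each element independently
with probability `p`. -/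
noncomputable def bernSum (U : Finset ι) (p : ℝ) (F : Finset ι → ℝ) : ℝ :=
  ∑ S ∈ U.powerset, p ^ S.card * (1 - p) ^ (U \ S).card * F S

variable {U : Finset ι} {p : ℝ}

theorem bernSum_congr {F H : Finset ι → ℝ} (h : ∀ S ⊆ U, F S = H S) :
    bernSum U p F = bernSum U p H :=
  Finset.sum_congr rfl fun S hS => by rw [h S (Finset.mem_powerset.1 hS)]

theorem bernSum_add (F H : Finset ι → ℝ) :
    bernSum U p (fun S => F S + H S) = bernSum U p F + bernSum U p H := by
  simp only [bernSum, mul_add, Finset.sum_add_distrib]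

theorem bernSum_const_mul (c : ℝ) (F : Finset ι → ℝ) :
    bernSum U p (fun S => c * F S) = c * bernSum U p F := by
  simp only [bernSum, Finset.mul_sum]
  exact Finset.sum_congr rfl fun S _ => by ring

theorem bernSum_sub (F H : Finset ι → ℝ) :
    bernSum U p (fun S => F S - H S) = bernSum U p F - bernSum U p H := by
  simp only [bernSum, mul_sub, Finset.sum_sub_distrib]

theorem bernSum_sum {κ : Type*} (s : Finset κ) (F : κ → Finset ι → ℝ) :
    bernSum U p (fun S => ∑ k ∈ s, F k S) = ∑ k ∈ s, bernSum U p (F k) := by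
  simp only [bernSum, Finset.mul_sum]
  exact Finset.sum_comm

theorem bernSum_mono (h0 : 0 ≤ p) (h1 : p ≤ 1) {F H : Finset ι → ℝ} (h : ∀ S, F S ≤ H S) :
    bernSum U p F ≤ bernSum U p H := by
  have : 0 ≤ 1 - p := by linarith
  exact Finset.sum_le_sum fun S _ => mul_le_mul_of_nonneg_left (h S) (by positivity)

theorem bernSum_insert {e : ι} (he : e ∉ U) (F : Finset ι → ℝ) :
    bernSum (insert e U) p F =
      (1 - p) * bernSum U p F + p * bernSum U p (fun S => F (insert e S)) := by
  rw [bernSum, Finset.sum_powerset_insert he, bernSum, bernSum, Finset.mul_sum, Finset.mul_sum]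
  congr 1
  · refine Finset.sum_congr rfl fun S hS => ?_
    have heS : e ∉ S := fun h => he (Finset.mem_powerset.1 hS h)
    rw [Finset.insert_sdiff_of_notMem _ heS, Finset.card_insert_of_notMem (by simp [he]), pow_succ]
    ring
  · refine Finset.sum_congr rfl fun S hS => ?_
    have heS : e ∉ S := fun h => he (Finset.mem_powerset.1 hS h)
    have : insert e U \ insert e S = U \ S := by
      ext x; simp only [Finset.mem_sdiff, Finset.mem_insert]; grind
    rw [this, Finset.card_insert_of_notMem heS, pow_succ]
    ring

/-- Conditioning on whether `e` belongs to the random subset. -/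
theorem bernSum_eq_condition {e : ι} (he : e ∈ U) (F : Finset ι → ℝ) :
    bernSum U p F = p * bernSum U p (fun S => F (insert e S)) +
      (1 - p) * bernSum U p (fun S => F (S.erase e)) := by
  obtain ⟨U', he', rfl⟩ : ∃ U', e ∉ U' ∧ insert e U' = U :=
    ⟨U.erase e, Finset.notMem_erase e U, Finset.insert_erase he⟩
  rw [bernSum_insert he', bernSum_insert he', bernSum_insert he']
  have h1 : bernSum U' p (fun S => F (S.erase e)) = bernSum U' p F :=
    bernSum_congr fun S hS => by rw [Finset.erase_eq_of_notMem fun h => he' (hS h)]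
  have h2 : bernSum U' p (fun S => F ((insert e S).erase e)) = bernSum U' p F :=
    bernSum_congr fun S hS => by rw [Finset.erase_insert fun h => he' (hS h)]
  simp only [Finset.insert_idem]
  rw [h1, h2]
  ring

theorem bernSum_const (c : ℝ) : bernSum U p (fun _ => c) = c := by
  induction U using Finset.induction_on with
  | empty => simp [bernSum]
  | insert e U he ih => rw [bernSum_insert he, ih]; ring

/-- Integration by parts for a centered Bernoulli variable. -/
theorem bernSum_centered_mul {e : ι} (he : e ∈ U) (F : Finset ι → ℝ) :
    bernSum U p (fun S => ((if e ∈ S then 1 else 0) - p) * F S) =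
      p * (1 - p) * bernSum U p (fun S => F (insert e S) - F (S.erase e)) := by
  rw [bernSum_eq_condition he]
  simp only [Finset.mem_insert_self, if_true, Finset.notMem_erase, if_false, bernSum_const_mul,
    bernSum_sub]
  ring

/-- The weight (`1 - p` if present, `p` if absent) is chosen so that the factor `p (1 - p)` of
`bernSum_centered_mul` reappears, with a sum in place of the difference; this converts the flipped
configurations back to the original measure. -/
theorem bernSum_weight_mul {e : ι} (he : e ∈ U) (F : Finset ι → ℝ) :
    bernSum U p (fun S => (if e ∈ S then 1 - p else p) * F S) =
      p * (1 - p) * bernSum U p (fun S => F (insert e S) + F (S.erase e)) := by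
  rw [bernSum_eq_condition he]
  simp only [Finset.mem_insert_self, if_true, Finset.notMem_erase, if_false, bernSum_const_mul,
    bernSum_add]
  ring

theorem bernSum_prod {T : Finset ι} (hT : T ⊆ U) (x y : ℝ) :
    bernSum U p (fun S => ∏ e ∈ T, if e ∈ S then x else y) = (p * x + (1 - p) * y) ^ T.card := by
  induction T using Finset.induction_on with
  | empty => simp [bernSum_const]
  | insert e T he ih =>
    have hTU : T ⊆ U := (Finset.subset_insert e T).trans hT
    have heU : e ∈ U := hT (Finset.mem_insert_self e T)
    have h1 : ∀ S : Finset ι, (∏ f ∈ T, if f ∈ insert e S then x else y) =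
        ∏ f ∈ T, if f ∈ S then x else y := fun S => Finset.prod_congr rfl fun f hf => by
      have : f ≠ e := fun h => he (h ▸ hf)
      simp [this]
    have h2 : ∀ S : Finset ι, (∏ f ∈ T, if f ∈ S.erase e then x else y) =
        ∏ f ∈ T, if f ∈ S then x else y := fun S => Finset.prod_congr rfl fun f hf => by
      have : f ≠ e := fun h => he (h ▸ hf)
      simp [this]
    rw [bernSum_eq_condition heU]
    simp only [Finset.prod_insert he, h1, h2, Finset.mem_insert_self, if_true,
      Finset.notMem_erase, if_false, bernSum_const_mul, ih hTU]
    rw [Finset.card_insert_of_notMem he, pow_succ]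
    ring

end Bernoulli

/-! ### The binomial random graph as a finite sum. -/

section RandomGraph

open MeasureTheory ProbabilityTheory

variable {V : Type*} [Fintype V] [DecidableEq V]

variable (V) in
/-- The possible edges of a graph on `V`. -/
def allEdges : Finset (Sym2 V) := Finset.univ.filter fun e => ¬ e.IsDiag

open Classical in
/-- The probability of a set of graphs as a finite sum over edge sets. -/
theorem binomialRandom_real_eq_bernSum (p : unitInterval) (T : Set (SimpleGraph V)) :
    (SimpleGraph.binomialRandom V p).real T =
      bernSum (allEdges V) p
        (fun S => if SimpleGraph.fromEdgeSet (S : Set (Sym2 V)) ∈ T then 1 else 0) := by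
  have hU : ((allEdges V : Finset (Sym2 V)) : Set (Sym2 V)) = Sym2.diagSetᶜ := by
    ext e; simp [allEdges]
  have hT : MeasurableSet T := by
    rw [← Set.preimage_image_eq T SimpleGraph.edgeSet_injective]
    exact SimpleGraph.measurable_edgeSet (Set.toFinite _).measurableSet
  rw [measureReal_def, SimpleGraph.binomialRandom_eq_map,
    Measure.map_apply SimpleGraph.measurable_fromEdgeSet hT, ← hU,
    setBernoulli_apply_eq_apply_subsets, ← measureReal_def]
  have hB : {s : Set (Sym2 V) | s ∈ SimpleGraph.fromEdgeSet ⁻¹' T ∧ s ⊆ (allEdges V : Set (Sym2 V))} =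
      ⋃ S ∈ (allEdges V).powerset.filter
        (fun S : Finset (Sym2 V) => SimpleGraph.fromEdgeSet (S : Set (Sym2 V)) ∈ T), {(S : Set (Sym2 V))} := by
    ext s
    simp only [Set.mem_ofPred_eq, Set.mem_preimage, Set.mem_iUnion, Finset.mem_filter,
      Finset.mem_powerset, Set.mem_singleton_iff, exists_prop]
    constructor
    · rintro ⟨h1, h2⟩
      refine ⟨s.toFinset, ⟨?_, by simpa using h1⟩, by simp⟩
      intro e he
      exact h2 (by simpa using he)
    · rintro ⟨S, ⟨h1, h2⟩, rfl⟩
      exact ⟨h2, by exact_mod_cast h1⟩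
  rw [hB, measureReal_biUnion_finset]
  · rw [bernSum, Finset.sum_filter]
    refine Finset.sum_congr rfl fun S hS => ?_
    split_ifs
    · rw [setBernoulli_real_singleton p (by exact_mod_cast Finset.mem_powerset.1 hS)
        (Finset.finite_toSet _), mul_one, ← Finset.coe_sdiff, Set.ncard_coe_finset,
        Set.ncard_coe_finset]
    · simp
  · intro S _ S' _ h
    simpa using h
  · intro S _
    exact (Set.toFinite _).measurableSet

end RandomGraph

/-! ### Moments of the centered adjacency matrix. -/

section Moments

variable {V : Type*} [DecidableEq V]

/-- The adjacency matrix of the graph with edge set `S`, minus its mean off the diagonal. -/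
def centeredAdj (p : ℝ) (S : Finset (Sym2 V)) : Matrix V V ℝ :=
  Matrix.of fun i j => if i = j then 0 else (if s(i, j) ∈ S then 1 else 0) - p

/-- The weight of a pair in the variance proxy. -/
def pairWeight (p : ℝ) (S : Finset (Sym2 V)) (i j : V) : ℝ :=
  if i = j then 0 else if s(i, j) ∈ S then 1 - p else p

theorem centeredAdj_isSymm (p : ℝ) (S : Finset (Sym2 V)) : (centeredAdj p S).IsSymm := by
  ext i j
  simp only [centeredAdj, transpose_apply, of_apply, eq_comm (a := j), Sym2.eq_swap (a := j)]

theorem pairWeight_comm (p : ℝ) (S : Finset (Sym2 V)) (i j : V) :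
    pairWeight p S i j = pairWeight p S j i := by
  simp only [pairWeight, eq_comm (a := j), Sym2.eq_swap (a := j)]

theorem pairWeight_nonneg {p : ℝ} (h0 : 0 ≤ p) (h1 : p ≤ 1) (S : Finset (Sym2 V)) (i j : V) :
    0 ≤ pairWeight p S i j := by
  unfold pairWeight
  split_ifs <;> linarith

theorem centeredAdj_insert_sub_erase (p : ℝ) (S : Finset (Sym2 V)) {i j : V} (h : i ≠ j) :
    centeredAdj p (insert s(i, j) S) - centeredAdj p (S.erase s(i, j)) =
      Matrix.single i j 1 + Matrix.single j i 1 := by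
  ext a b
  simp only [centeredAdj, Matrix.sub_apply, Matrix.add_apply, of_apply, Matrix.single_apply,
    Finset.mem_insert, Finset.mem_erase, Sym2.eq_iff]
  by_cases h1 : i = a ∧ j = b
  · obtain ⟨rfl, rfl⟩ := h1
    simp [h, h.symm]
  · by_cases h2 : j = a ∧ i = b
    · obtain ⟨rfl, rfl⟩ := h2
      simp [h, h.symm]
    · have h3 : ¬ (a = i ∧ b = j ∨ a = j ∧ b = i) := by grind
      simp [h1, h2, h3]

variable [Fintype V]

/-- The variance proxy of a row of the centered adjacency matrix. -/
def rowWeight (p : ℝ) (S : Finset (Sym2 V)) (i : V) : ℝ := ∑ j, pairWeight p S i j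

theorem rowWeight_nonneg {p : ℝ} (h0 : 0 ≤ p) (h1 : p ≤ 1) (S : Finset (Sym2 V)) (i : V) :
    0 ≤ rowWeight p S i :=
  Finset.sum_nonneg fun j _ => pairWeight_nonneg h0 h1 S i j

theorem mem_allEdges {i j : V} (h : i ≠ j) : s(i, j) ∈ allEdges V := by
  simp [allEdges, h]

theorem trace_single_add_single_mul (i j : V) (B : Matrix V V ℝ) :
    trace ((Matrix.single i j 1 + Matrix.single j i 1) * B) = B j i + B i j := by
  rw [add_mul, trace_add, Matrix.trace_single_mul, Matrix.trace_single_mul]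
  simp

theorem single_add_single_sq {i j : V} (h : i ≠ j) :
    (Matrix.single i j (1 : ℝ) + Matrix.single j i 1) ^ 2 =
      Matrix.single i i 1 + Matrix.single j j 1 := by
  rw [sq, add_mul, mul_add, mul_add]
  simp [Matrix.single_mul_single_of_ne, h, h.symm]

theorem isSymm_pow {X : Matrix V V ℝ} (h : X.IsSymm) (n : ℕ) : (X ^ n).IsSymm := by
  rw [Matrix.IsSymm, transpose_pow, h.eq]

/-- Flipping one edge changes the matrix by `E_ij + E_ji`, whose square is `E_ii + E_jj`. The trace
mean value inequality therefore sees only two equal off-diagonal entries on the left, whence the `4`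
in place of `2`, and diagonal entries on the right. -/
theorem entry_pow_sub_pow_le (p : ℝ) (S : Finset (Sym2 V)) {i j : V} (h : i ≠ j) (m : ℕ) :
    (centeredAdj p (insert s(i, j) S) ^ (2 * m + 1)) j i -
        (centeredAdj p (S.erase s(i, j)) ^ (2 * m + 1)) j i ≤
      (2 * m + 1) / 4 *
        (((centeredAdj p (insert s(i, j) S) ^ (2 * m)) i i +
          (centeredAdj p (insert s(i, j) S) ^ (2 * m)) j j) +
        ((centeredAdj p (S.erase s(i, j)) ^ (2 * m)) i i +
          (centeredAdj p (S.erase s(i, j)) ^ (2 * m)) j j)) := by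
  have hX := centeredAdj_isSymm p (insert s(i, j) S)
  have hY := centeredAdj_isSymm p (S.erase s(i, j))
  have key := trace_sub_mul_pow_sub_pow_le hX hY m
  rw [centeredAdj_insert_sub_erase p S h, single_add_single_sq h,
    trace_single_add_single_mul, add_mul, trace_add, Matrix.trace_single_mul,
    Matrix.trace_single_mul] at key
  have s1 := (isSymm_pow hX (2 * m + 1)).apply i j
  have s2 := (isSymm_pow hY (2 * m + 1)).apply i j
  simp only [Matrix.sub_apply, Matrix.add_apply, one_mul, smul_eq_mul] at key
  rw [s1, s2] at key
  linarith

theorem trace_centeredAdj_pow (p : ℝ) (S : Finset (Sym2 V)) (n : ℕ) :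
    trace (centeredAdj p S ^ (n + 1)) = ∑ i, ∑ j, if i = j then 0 else
      ((if s(i, j) ∈ S then 1 else 0) - p) * (centeredAdj p S ^ n) j i := by
  rw [pow_succ', trace]
  refine Finset.sum_congr rfl fun i _ => ?_
  rw [diag_apply, mul_apply]
  refine Finset.sum_congr rfl fun j _ => ?_
  nth_rewrite 1 [centeredAdj]
  rw [of_apply]
  split_ifs <;> simp

theorem bernSum_entry_le {p : ℝ} (h0 : 0 ≤ p) (h1 : p ≤ 1) {i j : V} (h : i ≠ j) (m : ℕ) :
    bernSum (allEdges V) p (fun S =>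
        ((if s(i, j) ∈ S then 1 else 0) - p) * (centeredAdj p S ^ (2 * m + 1)) j i) ≤
      bernSum (allEdges V) p (fun S => (2 * m + 1) / 4 * (pairWeight p S i j *
        ((centeredAdj p S ^ (2 * m)) i i + (centeredAdj p S ^ (2 * m)) j j))) := by
  have h2 : 0 ≤ 1 - p := by linarith
  have hw : ∀ S : Finset (Sym2 V), pairWeight p S i j = if s(i, j) ∈ S then 1 - p else p := fun S => by
    simp [pairWeight, h]
  simp only [hw]
  rw [bernSum_centered_mul (mem_allEdges h) (fun S => (centeredAdj p S ^ (2 * m + 1)) j i),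
    bernSum_const_mul, bernSum_weight_mul (mem_allEdges h)
      (fun S => (centeredAdj p S ^ (2 * m)) i i + (centeredAdj p S ^ (2 * m)) j j),
    mul_left_comm]
  refine mul_le_mul_of_nonneg_left ?_ (mul_nonneg h0 h2)
  rw [← bernSum_const_mul]
  refine bernSum_mono h0 h1 fun S => ?_
  exact entry_pow_sub_pow_le p S h m

theorem bernSum_trace_pow_le {p : ℝ} (h0 : 0 ≤ p) (h1 : p ≤ 1) (m : ℕ) :
    bernSum (allEdges V) p (fun S => trace (centeredAdj p S ^ (2 * m + 2))) ≤
      (2 * m + 1) / 2 * bernSum (allEdges V) p (fun S =>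
        ∑ i, rowWeight p S i * (centeredAdj p S ^ (2 * m)) i i) := by
  have hsum : ∀ S : Finset (Sym2 V),
      ∑ i, ∑ j, (2 * m + 1) / 4 * (pairWeight p S i j *
        ((centeredAdj p S ^ (2 * m)) i i + (centeredAdj p S ^ (2 * m)) j j)) =
      (2 * m + 1) / 2 * ∑ i, rowWeight p S i * (centeredAdj p S ^ (2 * m)) i i := by
    intro S
    have hA : ∑ i, ∑ j, pairWeight p S i j * (centeredAdj p S ^ (2 * m)) i i =
        ∑ i, rowWeight p S i * (centeredAdj p S ^ (2 * m)) i i :=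
      Finset.sum_congr rfl fun i _ => by rw [rowWeight, Finset.sum_mul]
    have hB : ∑ i, ∑ j, pairWeight p S i j * (centeredAdj p S ^ (2 * m)) j j =
        ∑ i, rowWeight p S i * (centeredAdj p S ^ (2 * m)) i i := by
      rw [Finset.sum_comm, ← hA]
      exact Finset.sum_congr rfl fun i _ => Finset.sum_congr rfl fun j _ => by
        rw [pairWeight_comm]
    calc _ = (2 * m + 1) / 4 * (∑ i, ∑ j, pairWeight p S i j * (centeredAdj p S ^ (2 * m)) i i +
          ∑ i, ∑ j, pairWeight p S i j * (centeredAdj p S ^ (2 * m)) j j) := by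
          rw [← Finset.sum_add_distrib, Finset.mul_sum]
          refine Finset.sum_congr rfl fun i _ => ?_
          rw [← Finset.sum_add_distrib, Finset.mul_sum]
          exact Finset.sum_congr rfl fun j _ => by rw [mul_add]
      _ = _ := by rw [hA, hB]; ring
  rw [← bernSum_const_mul]
  simp only [← hsum]
  simp only [show 2 * m + 2 = 2 * m + 1 + 1 from rfl, trace_centeredAdj_pow, bernSum_sum]
  refine Finset.sum_le_sum fun i _ => Finset.sum_le_sum fun j _ => ?_
  by_cases h : i = j
  · simp [h, pairWeight]
  · simp only [h, if_false]
    exact bernSum_entry_le h0 h1 h m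

/-- The trace moments are controlled by the moments of the variance proxies. -/
theorem bernSum_trace_pow_le_rowWeight {p : ℝ} (h0 : 0 ≤ p) (h1 : p ≤ 1) (m : ℕ) :
    bernSum (allEdges V) p (fun S => trace (centeredAdj p S ^ (2 * (m + 1)))) ≤
      ((2 * m + 1) / 2) ^ (m + 1) *
        bernSum (allEdges V) p (fun S => ∑ i, rowWeight p S i ^ (m + 1)) := by
  set Φ := bernSum (allEdges V) p (fun S => trace (centeredAdj p S ^ (2 * (m + 1)))) with hΦ
  set Ψ := bernSum (allEdges V) p (fun S => ∑ i, rowWeight p S i ^ (m + 1)) with hΨ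
  -- With this Young parameter the factor `(2m+1)/2` cancels and `Φ` returns with coefficient `m /
  -- (m + 1) < 1`, so it can be absorbed on the left.
  have hc : (0 : ℝ) < 2 / (2 * m + 1) := by positivity
  have step : bernSum (allEdges V) p (fun S =>
        ∑ i, rowWeight p S i * (centeredAdj p S ^ (2 * m)) i i) ≤
      (2 / (2 * m + 1) : ℝ)⁻¹ ^ m / (m + 1) * Ψ + 2 / (2 * m + 1) * m / (m + 1) * Φ := by
    rw [hΦ, hΨ, ← bernSum_const_mul, ← bernSum_const_mul, ← bernSum_add]
    refine bernSum_mono h0 h1 fun S => ?_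
    rw [trace, Finset.mul_sum, Finset.mul_sum, ← Finset.sum_add_distrib]
    refine Finset.sum_le_sum fun i _ => ?_
    have := mul_diag_pow_le (centeredAdj_isSymm p S) i (rowWeight_nonneg h0 h1 S i) hc m
    rw [diag_apply]
    rw [mul_div_right_comm] at this
    exact this
  have h2 : Φ ≤ (2 * m + 1) / 2 * ((2 / (2 * m + 1) : ℝ)⁻¹ ^ m / (m + 1) * Ψ +
      2 / (2 * m + 1) * m / (m + 1) * Φ) :=
    (bernSum_trace_pow_le h0 h1 m).trans (mul_le_mul_of_nonneg_left step (by positivity))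
  rw [inv_div] at h2
  have hm : (0 : ℝ) < m + 1 := by positivity
  have hm' : (2 * m + 1 : ℝ) ≠ 0 := by positivity
  have h3 : (2 * m + 1) / 2 * (((2 * m + 1) / 2 : ℝ) ^ m / (m + 1) * Ψ +
      2 / (2 * m + 1) * m / (m + 1) * Φ) =
      (((2 * m + 1) / 2 : ℝ) ^ (m + 1) * Ψ + m * Φ) / (m + 1) := by
    rw [pow_succ]; field_simp
  rw [h3, le_div_iff₀ hm] at h2
  linarith

/-! ### Row weights and degrees: sums of independent variables. -/

theorem bernSum_prod_row {i : V} (p x y : ℝ) :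
    bernSum (allEdges V) p (fun S => ∏ j ∈ Finset.univ.erase i, if s(i, j) ∈ S then x else y) =
      (p * x + (1 - p) * y) ^ (Fintype.card V - 1) := by
  have hinj : Set.InjOn (fun j : V => s(i, j)) (Finset.univ.erase i : Finset V) :=
    fun a _ b _ h => Sym2.congr_right.1 h
  have hT : (Finset.univ.erase i).image (fun j : V => s(i, j)) ⊆ allEdges V := by
    intro e he
    obtain ⟨j, hj, rfl⟩ := Finset.mem_image.1 he
    exact mem_allEdges (Finset.ne_of_mem_erase hj).symm
  have := bernSum_prod (p := p) hT x y
  simp only [Finset.prod_image hinj] at this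
  rw [this, Finset.card_image_of_injOn hinj, Finset.card_erase_of_mem (Finset.mem_univ i),
    Finset.card_univ]

/-- The weights in a row are independent with mean `2 p (1 - p)`; use `exp x ≤ 1 + 2 x` on `[0, 1]`
and then `1 + x ≤ exp x` for each factor. -/
theorem bernSum_exp_rowWeight_le {p θ : ℝ} (h0 : 0 ≤ p) (h1 : p ≤ 1) (hθ0 : 0 ≤ θ) (hθ1 : θ ≤ 1)
    (i : V) :
    bernSum (allEdges V) p (fun S => Real.exp (θ * rowWeight p S i)) ≤
      Real.exp (4 * θ * (p * (Fintype.card V - 1 : ℕ))) := by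
  have he : ∀ S : Finset (Sym2 V), Real.exp (θ * rowWeight p S i) =
      ∏ j ∈ Finset.univ.erase i, if s(i, j) ∈ S then Real.exp (θ * (1 - p)) else Real.exp (θ * p) := by
    intro S
    rw [rowWeight, ← Finset.add_sum_erase _ _ (Finset.mem_univ i)]
    simp only [pairWeight, if_true, zero_add]
    rw [Finset.mul_sum, Real.exp_sum]
    refine Finset.prod_congr rfl fun j hj => ?_
    rw [if_neg (Finset.ne_of_mem_erase hj).symm]
    split_ifs <;> rfl
  simp only [he]
  rw [bernSum_prod_row]
  have hexp : ∀ a : ℝ, 0 ≤ a → a ≤ 1 → Real.exp (θ * a) ≤ 1 + 2 * (θ * a) := by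
    intro a ha0 ha1
    have hx0 : 0 ≤ θ * a := by positivity
    have := Real.abs_exp_sub_one_le (x := θ * a) (by rw [abs_of_nonneg hx0]; nlinarith)
    rw [abs_of_nonneg hx0] at this
    have := (abs_le.1 this).2
    linarith
  have hb : p * Real.exp (θ * (1 - p)) + (1 - p) * Real.exp (θ * p) ≤ Real.exp (4 * θ * p) := by
    have e1 := mul_le_mul_of_nonneg_left (hexp (1 - p) (by linarith) (by linarith)) h0
    have e2 := mul_le_mul_of_nonneg_left (hexp p h0 h1) (by linarith : (0 : ℝ) ≤ 1 - p)
    have e3 := Real.add_one_le_exp (4 * θ * p)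
    nlinarith [mul_nonneg hθ0 (sq_nonneg p)]
  calc _ ≤ Real.exp (4 * θ * p) ^ (Fintype.card V - 1) :=
        pow_le_pow_left₀ (by have : 0 ≤ 1 - p := by linarith
                             positivity) hb _
    _ = _ := by rw [← Real.exp_nat_mul]; ring_nf

/-- The `k`-th power of `y ≤ exp (y - 1)` at `y = θ x / k`. -/
theorem pow_le_exp_mul {x θ : ℝ} (hx : 0 ≤ x) (hθ : 0 < θ) {k : ℕ} (hk : 0 < k) :
    x ^ k ≤ (k / θ) ^ k * Real.exp (-k) * Real.exp (θ * x) := by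
  have hk' : (0 : ℝ) < k := by exact_mod_cast hk
  have h : θ * x / k ≤ Real.exp (θ * x / k - 1) := by
    have := Real.add_one_le_exp (θ * x / k - 1); linarith
  have h2 := pow_le_pow_left₀ (by positivity) h k
  rw [← Real.exp_nat_mul] at h2
  have h3 : (k : ℝ) * (θ * x / k - 1) = -k + θ * x := by field_simp; ring
  rw [h3, Real.exp_add] at h2
  calc x ^ k = (k / θ) ^ k * (θ * x / k) ^ k := by rw [← mul_pow]; congr 1; field_simp
    _ ≤ (k / θ) ^ k * (Real.exp (-k) * Real.exp (θ * x)) :=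
        mul_le_mul_of_nonneg_left h2 (by positivity)
    _ = _ := by ring

theorem bernSum_rowWeight_pow_le {p d : ℝ} (h0 : 0 ≤ p) (h1 : p ≤ 1) {k : ℕ} (hk : 0 < k)
    (hd : (k : ℝ) ≤ 2 * d) (hpd : p * (Fintype.card V - 1 : ℕ) ≤ d) (i : V) :
    bernSum (allEdges V) p (fun S => rowWeight p S i ^ k) ≤ (2 * d * Real.exp 1) ^ k := by
  have hk' : (0 : ℝ) < k := by exact_mod_cast hk
  have hd0 : 0 < d := by linarith
  -- This `θ` makes the exponent `4 θ d` equal to `2 k`; the hypothesis `k ≤ 2 d` is what keeps `θ ≤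
  -- 1`.
  set θ : ℝ := k / (2 * d) with hθ
  have hθ0 : 0 < θ := by positivity
  have hθ1 : θ ≤ 1 := (div_le_one (by positivity)).2 hd
  have hkθ : (k : ℝ) / θ = 2 * d := by rw [hθ]; field_simp
  calc _ ≤ bernSum (allEdges V) p (fun S =>
          ((2 * d) ^ k * Real.exp (-k)) * Real.exp (θ * rowWeight p S i)) :=
        bernSum_mono h0 h1 fun S => by
          rw [← hkθ]; exact pow_le_exp_mul (rowWeight_nonneg h0 h1 S i) hθ0 hk
    _ ≤ ((2 * d) ^ k * Real.exp (-k)) * Real.exp (2 * k) := by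
        rw [bernSum_const_mul]
        refine mul_le_mul_of_nonneg_left
          ((bernSum_exp_rowWeight_le h0 h1 hθ0.le hθ1 i).trans (Real.exp_le_exp.2 ?_))
          (by positivity)
        have : 4 * θ * d = 2 * k := by rw [hθ]; field_simp; norm_num
        rw [← this]
        exact mul_le_mul_of_nonneg_left hpd (by positivity)
    _ = _ := by
        rw [mul_pow (2 * d), mul_assoc, ← Real.exp_add, ← Real.exp_nat_mul]
        ring_nf

/-- The trace moment bound for the centered adjacency matrix. -/
theorem bernSum_trace_pow_le_moment {p d : ℝ} (h0 : 0 ≤ p) (h1 : p ≤ 1) {k : ℕ} (hk : 0 < k)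
    (hd : (k : ℝ) ≤ 2 * d) (hpd : p * (Fintype.card V - 1 : ℕ) ≤ d) :
    bernSum (allEdges V) p (fun S => trace (centeredAdj p S ^ (2 * k))) ≤
      Fintype.card V * (2 * d * Real.exp 1 * k) ^ k := by
  have hk' : (0 : ℝ) < k := by exact_mod_cast hk
  have hd0 : 0 < d := by linarith
  obtain ⟨m, rfl⟩ : ∃ m, k = m + 1 := ⟨k - 1, by omega⟩
  refine (bernSum_trace_pow_le_rowWeight h0 h1 m).trans ?_
  rw [bernSum_sum]
  have hs : ∑ i : V, bernSum (allEdges V) p (fun S => rowWeight p S i ^ (m + 1)) ≤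
      Fintype.card V * (2 * d * Real.exp 1) ^ (m + 1) := by
    refine (Finset.sum_le_sum fun i _ => bernSum_rowWeight_pow_le h0 h1 hk hd hpd i).trans ?_
    simp
  have hm : ((2 * m + 1) / 2 : ℝ) ^ (m + 1) ≤ ((m + 1 : ℕ) : ℝ) ^ (m + 1) :=
    pow_le_pow_left₀ (by positivity) (by push_cast; linarith) _
  calc _ ≤ ((2 * m + 1) / 2 : ℝ) ^ (m + 1) * (Fintype.card V * (2 * d * Real.exp 1) ^ (m + 1)) :=
        mul_le_mul_of_nonneg_left hs (by positivity)
    _ ≤ ((m + 1 : ℕ) : ℝ) ^ (m + 1) * (Fintype.card V * (2 * d * Real.exp 1) ^ (m + 1)) :=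
        mul_le_mul_of_nonneg_right hm (by positivity)
    _ = _ := by rw [mul_pow _ (((m + 1 : ℕ) : ℝ))]; ring

/-- The number of edges of `S` at the vertex `i`. -/
def edgeDegree (S : Finset (Sym2 V)) (i : V) : ℝ :=
  ∑ j ∈ Finset.univ.erase i, if s(i, j) ∈ S then 1 else 0

/-- The lower-tail Chernoff estimate: since `exp (-1/10) ≤ 10/11`, each factor is at most `1 - p /
11`. -/
theorem bernSum_exp_neg_edgeDegree_le {p : ℝ} (h0 : 0 ≤ p) (h1 : p ≤ 1) (i : V) :
    bernSum (allEdges V) p (fun S => Real.exp (-(1 / 10 * edgeDegree S i))) ≤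
      Real.exp (-(1 / 11 * (p * (Fintype.card V - 1 : ℕ)))) := by
  have he : ∀ S : Finset (Sym2 V), Real.exp (-(1 / 10 * edgeDegree S i)) =
      ∏ j ∈ Finset.univ.erase i, if s(i, j) ∈ S then Real.exp (-(1 / 10)) else 1 := by
    intro S
    rw [edgeDegree, Finset.mul_sum, ← Finset.sum_neg_distrib, Real.exp_sum]
    refine Finset.prod_congr rfl fun j hj => ?_
    split_ifs <;> simp
  simp only [he]
  rw [bernSum_prod_row]
  have h11 : Real.exp (-(1 / 10)) ≤ 10 / 11 := by
    rw [Real.exp_neg, inv_le_comm₀ (Real.exp_pos _) (by norm_num)]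
    have := Real.add_one_le_exp (1 / 10 : ℝ)
    linarith
  have hb : p * Real.exp (-(1 / 10)) + (1 - p) * 1 ≤ Real.exp (-(1 / 11 * p)) := by
    have e1 := mul_le_mul_of_nonneg_left h11 h0
    have e3 := Real.add_one_le_exp (-(1 / 11 * p))
    linarith
  calc _ ≤ Real.exp (-(1 / 11 * p)) ^ (Fintype.card V - 1) :=
        pow_le_pow_left₀ (by have : 0 ≤ 1 - p := by linarith
                             positivity) hb _
    _ = _ := by rw [← Real.exp_nat_mul]; ring_nf

end Moments

/-! ### From norm and degree bounds to the spectral rate. -/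

section Deterministic

variable {N : ℕ}

/-- A rank-one positive semidefinite perturbation moves only the largest eigenvalue. -/
theorem abs_eigenvalues₀_le_of_rank_one {P : Matrix (Fin N) (Fin N) ℝ} (hP : P.IsHermitian)
    (v : Fin N → ℝ) {q η : ℝ} (hq : 0 ≤ q)
    (h : ∀ y : Fin N → ℝ, |y ⬝ᵥ P *ᵥ y - q * (v ⬝ᵥ y) ^ 2| ≤ η * (y ⬝ᵥ y))
    (i : Fin (Fintype.card (Fin N))) (hi : 1 ≤ (i : ℕ)) : |hP.eigenvalues₀ i| ≤ η := by
  let e : Fin (Fintype.card (Fin N)) ≃ Fin N :=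
    Fintype.equivOfCardEq (Fintype.card_fin (Fintype.card (Fin N)))
  let u : Fin (Fintype.card (Fin N)) → Fin N → ℝ := fun a => (hP.eigenvectorBasis (e a)).ofLp
  have hu : ∀ a, P *ᵥ u a = hP.eigenvalues₀ a • u a := by
    intro a
    have := hP.mulVec_eigenvectorBasis (e a)
    simp only [IsHermitian.eigenvalues] at this
    have h2 : (Fintype.equivOfCardEq (Fintype.card_fin (Fintype.card (Fin N)))).symm (e a) = a :=
      e.symm_apply_apply a
    rw [h2] at this
    exact this
  have horth : ∀ a b, u a ⬝ᵥ u b = if a = b then 1 else 0 := by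
    intro a b
    have := orthonormal_iff_ite.1 hP.eigenvectorBasis.orthonormal (e b) (e a)
    rw [EuclideanSpace.inner_eq_star_dotProduct] at this
    simpa [u, eq_comm] using this
  have hself : u i ⬝ᵥ u i = 1 := by simp [horth]
  -- From below, the eigenvector itself is a test vector, because the rank-one term is nonnegative.
  have hlow : -η ≤ hP.eigenvalues₀ i := by
    have h1 := (abs_le.1 (h (u i))).1
    rw [hu, dotProduct_smul, hself] at h1
    have := mul_nonneg hq (sq_nonneg (v ⬝ᵥ u i))
    simp only [smul_eq_mul, mul_one] at h1
    linarith
  refine abs_le.2 ⟨hlow, ?_⟩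
  let o : Fin (Fintype.card (Fin N)) := ⟨0, by omega⟩
  have hoi : o ≠ i := fun h => by
    have := congrArg Fin.val h
    simp only [o] at this
    omega
  have hanti : hP.eigenvalues₀ i ≤ hP.eigenvalues₀ o :=
    hP.eigenvalues₀_antitone (Fin.mk_le_of_le_val (Nat.zero_le _))
  -- The span of the top and the `i`-th eigenvector contains a nonzero vector orthogonal to `v`.
  -- There the rank-one term vanishes, while the form of `P` is at least the `i`-th eigenvalue times
  -- the squared norm.
  obtain ⟨α, β, hαβ, hv⟩ : ∃ α β : ℝ, 0 < α ^ 2 + β ^ 2 ∧ α * (v ⬝ᵥ u o) + β * (v ⬝ᵥ u i) = 0 := by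
    by_cases h0 : v ⬝ᵥ u o = 0
    · exact ⟨1, 0, by norm_num, by simp [h0]⟩
    · exact ⟨-(v ⬝ᵥ u i), v ⬝ᵥ u o, by positivity, by ring⟩
  have h1 := (abs_le.1 (h (α • u o + β • u i))).2
  have e1 : v ⬝ᵥ (α • u o + β • u i) = 0 := by
    rw [dotProduct_add, dotProduct_smul, dotProduct_smul]; exact hv
  have e2 : (α • u o + β • u i) ⬝ᵥ (α • u o + β • u i) = α ^ 2 + β ^ 2 := by
    simp only [dotProduct_add, add_dotProduct, dotProduct_smul, smul_dotProduct, horth, hoi,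
      hoi.symm, if_true, if_false, smul_eq_mul]
    ring
  have e3 : (α • u o + β • u i) ⬝ᵥ P *ᵥ (α • u o + β • u i) =
      hP.eigenvalues₀ o * α ^ 2 + hP.eigenvalues₀ i * β ^ 2 := by
    rw [mulVec_add, mulVec_smul, mulVec_smul, hu, hu]
    simp only [dotProduct_add, add_dotProduct, dotProduct_smul, smul_dotProduct, horth, hoi,
      hoi.symm, if_true, if_false, smul_eq_mul]
    ring
  rw [e1, e2, e3] at h1
  have h2 : hP.eigenvalues₀ i * (α ^ 2 + β ^ 2) ≤ η * (α ^ 2 + β ^ 2) := by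
    nlinarith [mul_le_mul_of_nonneg_right hanti (sq_nonneg α)]
  exact le_of_mul_le_mul_right h2 hαβ

theorem propagation_eq (G : SimpleGraph (Fin N)) :
    propagation G = augDegInvSqrt G * augAdj G * augDegInvSqrt G := by
  simp [propagation, augNormLaplacian]

theorem augAdj_fromEdgeSet (p : ℝ) (S : Finset (Sym2 (Fin N))) :
    augAdj (SimpleGraph.fromEdgeSet (S : Set (Sym2 (Fin N)))) =
      p • Matrix.of (fun _ _ => 1) + (1 - p) • 1 + centeredAdj p S := by
  ext i j
  by_cases h : i = j
  · subst h; simp [augAdj, centeredAdj]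
  · simp [augAdj, centeredAdj, SimpleGraph.adjMatrix_apply, h]

theorem augDeg_fromEdgeSet (S : Finset (Sym2 (Fin N))) (i : Fin N) :
    augDeg (SimpleGraph.fromEdgeSet (S : Set (Sym2 (Fin N)))) i = edgeDegree S i + 1 := by
  classical
  rw [augDeg, edgeDegree, ← SimpleGraph.card_neighborFinset_eq_degree,
    SimpleGraph.neighborFinset_eq_filter, Finset.sum_boole]
  congr 2
  congr 1
  ext j
  simp [SimpleGraph.fromEdgeSet_adj, and_comm, eq_comm]

theorem dotProduct_augAdj_mulVec (p : ℝ) (S : Finset (Sym2 (Fin N))) (z : Fin N → ℝ) :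
    z ⬝ᵥ augAdj (SimpleGraph.fromEdgeSet (S : Set (Sym2 (Fin N)))) *ᵥ z =
      p * (∑ i, z i) ^ 2 + (1 - p) * (z ⬝ᵥ z) + z ⬝ᵥ centeredAdj p S *ᵥ z := by
  rw [augAdj_fromEdgeSet p, add_mulVec, add_mulVec, smul_mulVec, smul_mulVec, one_mulVec,
    dotProduct_add, dotProduct_add, dotProduct_smul, dotProduct_smul]
  have : z ⬝ᵥ Matrix.of (fun _ _ : Fin N => (1 : ℝ)) *ᵥ z = (∑ i, z i) ^ 2 := by
    simp [dotProduct, mulVec, sq, Finset.sum_mul]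
  rw [this, smul_eq_mul, smul_eq_mul]

theorem numComponents_pos (G : SimpleGraph (Fin N)) (hN : 0 < N) : 1 ≤ numComponents G := by
  have : Nonempty (Fin N) := ⟨⟨0, hN⟩⟩
  have : Nonempty G.ConnectedComponent := ⟨G.connectedComponentMk (Classical.arbitrary _)⟩
  exact Nat.card_pos

/-- Degree concentration and a trace moment bound control the spectral rate. -/
theorem spectralRate_le {p t δ : ℝ} (h0 : 0 ≤ p) (h1 : p ≤ 1) (ht : 0 ≤ t) (hδ : 0 < δ)
    {S : Finset (Sym2 (Fin N))} {k : ℕ} (hk : k ≠ 0)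
    (htr : trace (centeredAdj p S ^ (2 * k)) ≤ t ^ (2 * k))
    (hdeg : ∀ i, δ ≤ edgeDegree S i + 1) :
    spectralRate (SimpleGraph.fromEdgeSet (S : Set (Sym2 (Fin N)))) ≤ (1 + t) / δ := by
  set G := SimpleGraph.fromEdgeSet (S : Set (Sym2 (Fin N))) with hG
  refine Real.iSup_le (fun i => ?_) (by positivity)
  have hN : 0 < N := by
    have := i.1.2.trans_eq (Fintype.card_fin N)
    omega
  refine abs_eigenvalues₀_le_of_rank_one _ (fun a => (Real.sqrt (augDeg G a))⁻¹) h0 (fun y => ?_)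
    i.1 ((numComponents_pos G hN).trans i.2)
  set z : Fin N → ℝ := augDegInvSqrt G *ᵥ y with hz
  have hza : ∀ a, z a = (Real.sqrt (augDeg G a))⁻¹ * y a := fun a => by
    rw [hz, augDegInvSqrt, mulVec_diagonal]
  have hquad : y ⬝ᵥ propagation G *ᵥ y = z ⬝ᵥ augAdj G *ᵥ z := by
    have hT : (augDegInvSqrt G)ᵀ = augDegInvSqrt G := by simp [augDegInvSqrt]
    rw [propagation_eq, ← mulVec_mulVec, ← mulVec_mulVec, dotProduct_mulVec, ← mulVec_transpose,
      hT]
  have hsum : (fun a => (Real.sqrt (augDeg G a))⁻¹) ⬝ᵥ y = ∑ a, z a :=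
    Finset.sum_congr rfl fun a _ => (hza a).symm
  rw [hquad, hsum, dotProduct_augAdj_mulVec p]
  have hX := abs_dotProduct_mulVec_le (centeredAdj_isSymm p S) ht hk htr z
  have hzz0 : 0 ≤ z ⬝ᵥ z := Finset.sum_nonneg fun a _ => mul_self_nonneg (z a)
  have hzz : z ⬝ᵥ z ≤ (y ⬝ᵥ y) / δ := by
    rw [dotProduct, dotProduct, Finset.sum_div]
    refine Finset.sum_le_sum fun a _ => ?_
    have hd : δ ≤ augDeg G a := by rw [hG, augDeg_fromEdgeSet]; exact hdeg a
    have hd0 : 0 < augDeg G a := hδ.trans_le hd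
    have : z a * z a = y a * y a / augDeg G a := by
      rw [hza, mul_mul_mul_comm, ← mul_inv, Real.mul_self_sqrt hd0.le]; field_simp
    rw [this]
    exact div_le_div_of_nonneg_left (mul_self_nonneg _) hδ hd
  calc _ = |(1 - p) * (z ⬝ᵥ z) + z ⬝ᵥ centeredAdj p S *ᵥ z| := by congr 1; ring
    _ ≤ |(1 - p) * (z ⬝ᵥ z)| + |z ⬝ᵥ centeredAdj p S *ᵥ z| := abs_add_le _ _
    _ ≤ (1 + t) * (z ⬝ᵥ z) := by
        rw [abs_of_nonneg (mul_nonneg (by linarith) hzz0)]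
        nlinarith [mul_nonneg h0 hzz0]
    _ ≤ (1 + t) * ((y ⬝ᵥ y) / δ) := mul_le_mul_of_nonneg_left hzz (by linarith)
    _ = _ := by ring

theorem spectralRate_nonneg (G : SimpleGraph (Fin N)) : 0 ≤ spectralRate G :=
  Real.iSup_nonneg fun _ => abs_nonneg _

end Deterministic

/-! ### Choice of parameters and the union bound. -/

section Probability

variable {N : ℕ}

theorem trace_even_pow_nonneg {V : Type*} [Fintype V] [DecidableEq V] {X : Matrix V V ℝ}
    (hX : X.IsSymm) (k : ℕ) : 0 ≤ trace (X ^ (2 * k)) := by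
  obtain ⟨U, l, -, hU, hUX⟩ := exists_diagonalization hX
  rw [hUX, trace_diagonalized hU]
  exact Finset.sum_nonneg fun a _ => (even_two_mul k).pow_nonneg _

/-- The base of the ratio is `e k / (18 L) ≤ e / 9 ≤ 1 / e`, by `k ≤ 2 L` and `e^2 ≤ 9`; the power
`k ≥ L` does the rest. -/
theorem moment_ratio_le {d L : ℝ} (hd : 0 < d) (hL : 1 ≤ L) {k : ℕ} (hkL : L ≤ k)
    (hk2 : (k : ℝ) ≤ 2 * L) :
    (2 * d * Real.exp 1 * k) ^ k / (6 * Real.sqrt (d * L)) ^ (2 * k) ≤ Real.exp (-L) := by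
  have hL0 : 0 < L := by linarith
  have hsq : (6 * Real.sqrt (d * L)) ^ 2 = 36 * (d * L) := by
    rw [mul_pow, Real.sq_sqrt (by positivity)]; norm_num
  rw [pow_mul, hsq, ← div_pow]
  have he : Real.exp 1 * Real.exp 1 ≤ 9 := by
    have := Real.exp_one_lt_d9
    have := Real.exp_pos 1
    nlinarith
  have hb : 2 * d * Real.exp 1 * k / (36 * (d * L)) ≤ Real.exp (-1) := by
    rw [div_le_iff₀ (by positivity), Real.exp_neg, inv_mul_eq_div, le_div_iff₀ (Real.exp_pos 1)]
    calc 2 * d * Real.exp 1 * k * Real.exp 1 = (2 * d) * (Real.exp 1 * Real.exp 1) * k := by ring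
      _ ≤ (2 * d) * 9 * (2 * L) := by gcongr
      _ = _ := by ring
  calc _ ≤ Real.exp (-1) ^ k := pow_le_pow_left₀ (by positivity) hb k
    _ = Real.exp (-k) := by rw [← Real.exp_nat_mul]; ring_nf
    _ ≤ _ := Real.exp_le_exp.2 (by linarith)

/-- The slack between `6` and `7 * 9 / 10 = 6.3` absorbs the summand `1`, since `√(d L) ≥ 10`. -/
theorem bound_le {d L : ℝ} (hL : 1 ≤ L) (hd : 100 ≤ d) :
    (1 + 6 * Real.sqrt (d * L)) / (9 / 10 * d) ≤ 7 * Real.sqrt (L / d) := by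
  have hd0 : 0 < d := by linarith
  have h10 : 10 ≤ Real.sqrt (d * L) := Real.le_sqrt_of_sq_le (by nlinarith)
  have hs : Real.sqrt (L / d) * d = Real.sqrt (d * L) := by
    rw [show d * L = L / d * d ^ 2 by field_simp, Real.sqrt_mul (by positivity),
      Real.sqrt_sq hd0.le]
  rw [div_le_iff₀ (by positivity)]
  nlinarith

open Classical in
/-- The spectral rate of a dense enough binomial random graph is small with high probability. -/
theorem binomialRandom_spectralRate_le (p : unitInterval) {ε : ℝ} (hε : 0 < ε) (hN : 0 < N)
    (hL : 1 ≤ Real.log (4 * N / ε))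
    (hd : 1100 * Real.log (4 * N / ε) ≤ (N : ℝ) * p - p) :
    1 - ε ≤ (SimpleGraph.binomialRandom (Fin N) p).real
      {G | spectralRate G ≤ 7 * Real.sqrt (Real.log (4 * N / ε) / ((N : ℝ) * p - p + 1))} := by
  set L := Real.log (4 * N / ε) with hLdef
  set D : ℝ := (N : ℝ) * p - p with hD
  have hN' : (0 : ℝ) < N := by exact_mod_cast hN
  have h0 : (0 : ℝ) ≤ p := p.2.1
  have h1 : (p : ℝ) ≤ 1 := p.2.2
  have hcard : (p : ℝ) * (Fintype.card (Fin N) - 1 : ℕ) = D := by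
    rw [Fintype.card_fin, Nat.cast_sub hN, hD]; push_cast; ring
  have hNL : N * Real.exp (-L) = ε / 4 := by
    rw [Real.exp_neg, hLdef, Real.exp_log (by positivity)]; field_simp
  set k := ⌈L⌉₊ with hk
  have hkL : L ≤ k := Nat.le_ceil L
  have hk2 : (k : ℝ) ≤ 2 * L := by
    have := Nat.ceil_lt_add_one (by linarith : 0 ≤ L); linarith
  have hk0 : 0 < k := Nat.ceil_pos.2 (by linarith)
  set t := 6 * Real.sqrt ((D + 1) * L) with ht
  have ht0 : 0 < t := by
    have : 0 < (D + 1) * L := by nlinarith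
    positivity
  rw [binomialRandom_real_eq_bernSum]
  -- Markov and the union bound in pointwise form: off the good event, a degree below `9 D / 10` or
  -- a large trace makes one of the subtracted terms at least `1`.
  have hpoint : ∀ S : Finset (Sym2 (Fin N)),
      1 - (∑ i, Real.exp (9 / 100 * D) * Real.exp (-(1 / 10 * edgeDegree S i)) +
        (t ^ (2 * k))⁻¹ * trace (centeredAdj p S ^ (2 * k))) ≤
      if SimpleGraph.fromEdgeSet (S : Set (Sym2 (Fin N))) ∈
        {G | spectralRate G ≤ 7 * Real.sqrt (L / (D + 1))} then 1 else 0 := by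
    intro S
    have hs0 : ∀ i ∈ Finset.univ,
        0 ≤ Real.exp (9 / 100 * D) * Real.exp (-(1 / 10 * edgeDegree S i)) :=
      fun i _ => by positivity
    have htr0 : 0 ≤ (t ^ (2 * k))⁻¹ * trace (centeredAdj p S ^ (2 * k)) :=
      mul_nonneg (by positivity) (trace_even_pow_nonneg (centeredAdj_isSymm (p : ℝ) S) k)
    by_cases hdeg : ∀ i, 9 / 10 * D ≤ edgeDegree S i
    · by_cases htr : trace (centeredAdj p S ^ (2 * k)) ≤ t ^ (2 * k)
      · have hgood := (spectralRate_le h0 h1 ht0.le (by linarith : 0 < 9 / 10 * (D + 1)) hk0.ne' htr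
          (fun i => by linarith [hdeg i])).trans (bound_le hL (by linarith))
        rw [if_pos (by exact hgood)]
        linarith [Finset.sum_nonneg hs0]
      · have : 1 ≤ (t ^ (2 * k))⁻¹ * trace (centeredAdj p S ^ (2 * k)) := by
          rw [inv_mul_eq_div, one_le_div (by positivity)]
          exact (not_le.1 htr).le
        refine le_trans ?_ (by split_ifs <;> norm_num : (0 : ℝ) ≤ _)
        linarith [Finset.sum_nonneg hs0]
    · push Not at hdeg
      obtain ⟨i, hi⟩ := hdeg
      have h2 : 1 ≤ Real.exp (9 / 100 * D) * Real.exp (-(1 / 10 * edgeDegree S i)) := by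
        rw [← Real.exp_add]
        exact Real.one_le_exp (by linarith)
      have h3 := Finset.single_le_sum hs0 (Finset.mem_univ i)
      refine le_trans ?_ (by split_ifs <;> norm_num : (0 : ℝ) ≤ _)
      linarith
  refine le_trans ?_ (bernSum_mono h0 h1 hpoint)
  rw [bernSum_sub, bernSum_const, bernSum_add, bernSum_sum, bernSum_const_mul]
  simp only [bernSum_const_mul]
  have hA : ∑ i : Fin N, Real.exp (9 / 100 * D) *
      bernSum (allEdges (Fin N)) p (fun S => Real.exp (-(1 / 10 * edgeDegree S i))) ≤ ε / 4 := by
    have : ∀ i : Fin N, Real.exp (9 / 100 * D) *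
        bernSum (allEdges (Fin N)) p (fun S => Real.exp (-(1 / 10 * edgeDegree S i))) ≤
        Real.exp (-L) := by
      intro i
      have h := mul_le_mul_of_nonneg_left (bernSum_exp_neg_edgeDegree_le h0 h1 i)
        (Real.exp_pos (9 / 100 * D)).le
      rw [hcard, ← Real.exp_add] at h
      -- Here `1/11 - 9/100 = 1/1100`, the source of the constant in the density hypothesis.
      exact h.trans (Real.exp_le_exp.2 (by linarith))
    refine (Finset.sum_le_sum fun i _ => this i).trans ?_
    rw [Finset.sum_const, Finset.card_univ, Fintype.card_fin, nsmul_eq_mul, hNL]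
  have hB : (t ^ (2 * k))⁻¹ *
      bernSum (allEdges (Fin N)) p (fun S => trace (centeredAdj p S ^ (2 * k))) ≤ ε / 4 := by
    have hm := bernSum_trace_pow_le_moment (V := Fin N) (d := D + 1) h0 h1 hk0 (by linarith)
      (by rw [hcard]; linarith)
    have hr := moment_ratio_le (by linarith : 0 < D + 1) hL hkL hk2
    calc _ ≤ (t ^ (2 * k))⁻¹ * (Fintype.card (Fin N) * (2 * (D + 1) * Real.exp 1 * k) ^ k) :=
          mul_le_mul_of_nonneg_left hm (by positivity)
      _ = N * ((2 * (D + 1) * Real.exp 1 * k) ^ k / t ^ (2 * k)) := by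
          rw [Fintype.card_fin]; ring
      _ ≤ N * Real.exp (-L) := mul_le_mul_of_nonneg_left hr hN'.le
      _ = _ := hNL
  linarith

theorem eventually_dense (p : ℕ → unitInterval)
    (hp : (fun N : ℕ => Real.log (N : ℝ)) =o[atTop] fun N : ℕ => (N : ℝ) * (p N : ℝ))
    {ε : ℝ} (hε : 0 < ε) :
    ∀ᶠ N : ℕ in atTop, 0 < N ∧ 1 ≤ Real.log (4 * N / ε) ∧
      1100 * Real.log (4 * N / ε) ≤ (N : ℝ) * p N - p N := by
  have hlog : Tendsto (fun N : ℕ => Real.log (N : ℝ)) atTop atTop :=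
    Real.tendsto_log_atTop.comp tendsto_natCast_atTop_atTop
  -- Eventually `log (4 N / ε) ≤ 2 log N`, so `2200 log N ≤ N p - p` suffices. The constant `4400`
  -- leaves room for the lost `p ≤ 1 ≤ log N`.
  filter_upwards [hp.bound (by norm_num : (0 : ℝ) < 1 / 4400), eventually_gt_atTop 0,
    hlog.eventually_ge_atTop (Real.log (4 / ε)), hlog.eventually_ge_atTop (1 - Real.log (4 / ε)),
    hlog.eventually_ge_atTop 1] with N h1 h2 h3 h4 h5
  have hN' : (0 : ℝ) < N := by exact_mod_cast h2
  have hs : Real.log (4 * N / ε) = Real.log N + Real.log (4 / ε) := by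
    rw [← Real.log_mul (by positivity) (by positivity)]; congr 1; ring
  have hp0 : (0 : ℝ) ≤ p N := (p N).2.1
  have hp1 : (p N : ℝ) ≤ 1 := (p N).2.2
  rw [Real.norm_of_nonneg (by linarith), Real.norm_of_nonneg (by positivity)] at h1
  exact ⟨h2, by rw [hs]; linarith, by rw [hs]; linarith⟩

end Probability

end GraphConv

/-- The little-o hypothesis forces `p N > 0` for large `N`, as `log N` is then nonzero. Boundedness
of the singular values is assumed because the real `⨆` of an unbounded family defaults to `0`. -/
theorem theorem3 (p : ℕ → unitInterval)
    (hp : (fun N : ℕ => Real.log (N : ℝ)) =o[atTop] fun N : ℕ => (N : ℝ) * (p N : ℝ))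
    (ε : ℝ) (hε : 0 < ε) :
    ∃ N₀ : ℕ, ∀ N : ℕ, N₀ ≤ N → ∀ C : ℕ, 0 < C → ∀ W : ℕ → Matrix (Fin C) (Fin C) ℝ,
      BddAbove (Set.range fun l => GraphConv.maxSingularValue (W l)) →
      (⨆ l, GraphConv.maxSingularValue (W l)) <
        1 / 7 * Real.sqrt (((N : ℝ) * p N - p N + 1) / Real.log (4 * N / ε)) →
      1 - ε ≤ (SimpleGraph.binomialRandom (Fin N) (p N)).real
        {G : SimpleGraph (Fin N) | (GraphConv.GCN.mk G W).InfoLossCondition} := by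
  obtain ⟨N₀, hN₀⟩ := eventually_atTop.1 (GraphConv.eventually_dense p hp hε)
  refine ⟨N₀, fun N hN C _ W hW hs => ?_⟩
  obtain ⟨hN0, hL, hd⟩ := hN₀ N hN
  refine (GraphConv.binomialRandom_spectralRate_le (p N) hε hN0 hL hd).trans
    (MeasureTheory.measureReal_mono fun G hG => ⟨hW, ?_⟩)
  rw [Set.mem_ofPred_eq] at hG
  set L := Real.log (4 * N / ε)
  set d : ℝ := (N : ℝ) * p N - p N + 1
  have hL0 : 0 < L := by linarith
  have hd0 : 0 < d := by linarith
  have hone : 1 / 7 * Real.sqrt (d / L) * (7 * Real.sqrt (L / d)) = 1 := by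
    have : Real.sqrt (d / L) * Real.sqrt (L / d) = 1 := by
      rw [← Real.sqrt_mul (by positivity), div_mul_div_cancel₀ hL0.ne', div_self hd0.ne',
        Real.sqrt_one]
    linear_combination this
  have h0 := GraphConv.spectralRate_nonneg G
  change (⨆ l, GraphConv.maxSingularValue (W l)) * GraphConv.spectralRate G < 1
  -- Multiplying the strict bound on `s` by the rate stays strict only if the rate is positive; a
  -- zero rate is treated directly.
  rcases h0.eq_or_lt with h | h
  · rw [← h, mul_zero]; exact one_pos
  · calc _ < 1 / 7 * Real.sqrt (d / L) * GraphConv.spectralRate G := mul_lt_mul_of_pos_right hs h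
      _ ≤ 1 / 7 * Real.sqrt (d / L) * (7 * Real.sqrt (L / d)) :=
        mul_le_mul_of_nonneg_left hG (by positivity)
      _ = 1 := hone
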